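/- Let $m\ge 1$, let $K$ be a field of characteristic zero (for instance $K=\mathbb R$) and let $\lambda$ be an indeterminate. For $f=(f_0,\dots,f_m)\in K^{m+1}$ and $\alpha\in K$ put $$g=f_{m-1}\cdots f_1-\alpha,\qquad G=f_mf_{m-1}\cdots f_0-\alpha$$ (the empty product is $1$). Let $A$ and $B$ be the $(m+1)\times(m+1)$ matrices over $K(\lambda)$, with rows and columns numbered $0,\dots,m$, whose only nonzero entries are $$A_{s,s}=-f_s,\quad A_{s,s+1}=1,\qquad B_{s,s}=1,\quad B_{s,s+1}=-f_s\qquad (0\le s\le m-1)$$ and, in the last rows, $$A_{m,0}=\lambda,\quad A_{m,1}=-\frac{\lambda G}{gf_0},\quad A_{m,m}=\frac{G}{gf_0}-f_m,\qquad B_{m,0}=-\lambda f_m,\quad B_{m,1}=\lambda\frac{G}{g},\quad B_{m,m}=1-\frac{G}{g}$$ (if $m=1$, the two entries given for the position $(m,1)=(m,m)$ are added). Put $F[f,\alpha,\lambda]=B^{-1}A$ whenever this makes sense, that is, if $f_0\ne0$, $g\ne0$ and $\det B\ne0$. Below, $f^{(i)}$, $T_j(f^{(i)})$ etc. denote vectors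 with components $s=0,\dots,m-1$. In $F$, each such vector is completed by an arbitrary component with subscript $m$ for which $F$ makes sense; the statements below hold for every choice of these last components. "For generic values" means: outside the zero set of some nonzero polynomial, with coefficients in $K$, in the variables $f^{(i)}_s$, $0\le s\le m-1$, in question. Let parameters $\alpha^{(i)}\in K$ be assigned to the indices $i$, and for $0\le s\le m$ put $$P^{(i,j)}_s=\alpha^{(i)}f^{(j)}_{m-1}\cdots f^{(j)}_0-\alpha^{(j)}f^{(i)}_{m-1}\cdots f^{(i)}_0+\sum_{r=0}^{m-1}\gamma^{(i,j)}_{r,s}\,(f^{(i)}_r-f^{(j)}_r)\,f^{(i)}_{r-1}\cdots f^{(i)}_0\,f^{(j)}_{r-1}\cdots f^{(j)}_0,$$ where $\gamma^{(i,j)}_{r,s}=1$ if $s\le r$ and $\gamma^{(i,j)}_{r,s}=\alpha^{(i)}\alpha^{(j)}$ if $r<s$. (1) Let $\alpha^{(i)}\ne\alpha^{(j)}$ and, if $m=1$, let also $\alpha^{(i)}\ne1$ and $\alpha^{(j)}\ne1$. Then, for generic values of $f^{(i)},f^{(j)}$, the matrices $F[f^{(i)},\alpha^{(i)},\lambda]$,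 $F[f^{(j)},\alpha^{(j)},\lambda]$ make sense, and the equation $$F[T_i(f^{(j)}),\alpha^{(j)},\lambda]\,F[f^{(i)},\alpha^{(i)},\lambda]=F[T_j(f^{(i)}),\alpha^{(i)},\lambda]\,F[f^{(j)},\alpha^{(j)},\lambda],$$ considered as an identity with respect to $\lambda$, has one and only one solution $T_i(f^{(j)}),T_j(f^{(i)})\in K^m$ (among the vectors for which $F$ makes sense). The solution is $$T_j(f^{(i)}_s)=\frac{P^{(i,j)}_{s+1}}{f^{(j)}_sP^{(i,j)}_s},\qquad T_i(f^{(j)}_s)=\frac{P^{(j,i)}_{s+1}}{f^{(i)}_sP^{(j,i)}_s},\qquad s=0,\dots,m-1,$$ where the denominators do not vanish. (2) Let $\alpha^{(i)},\alpha^{(j)},\alpha^{(k)}$ be pairwise distinct. Then the mapping given by the above formula is 3D-consistent: for generic values of $f^{(i)},f^{(j)},f^{(k)}$, $$T_kT_j(f^{(i)}_s)=T_jT_k(f^{(i)}_s),\qquad s=0,\dots,m-1,$$ and no denominator in these expressions vanishes. Here $T_kT_j(f^{(i)})$ is obtained from the formula for $T_j(f^{(i)})$ by replacing $f^{(i)},f^{(j)}$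 with $T_k(f^{(i)}),T_k(f^{(j)})$. -/

import Mathlib

open Finset

namespace DSK

noncomputable section

variable {K : Type*} [Field K]

/-- The quantity `f_m f_{m-1} ⋯ f_0 - a`, for `f = (f_0, …, f_m)`. -/
def bigG {m : ℕ} (f : Fin (m + 1) → K) (a : K) : K :=
  (∏ s, f s) - a

/-- The quantity `f_{m-1} ⋯ f_1 - a`, for `f = (f_0, …, f_m)`
(the product is empty, hence equal to `1`, if `m = 1`). -/
def smallG {m : ℕ} (f : Fin (m + 1) → K) (a : K) : K :=
  (∏ s ∈ Finset.Ioo 0 (Fin.last m), f s) - a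

/-- The matrix `A`. Row `r < m` has the entry `-f_r` on the diagonal and `1` to the right of it; the
last row has `λ` in column `0`, `-λ G / (g f_0)` in column `1` and `G / (g f_0) - f_m` in
column `m` (for `m = 1` the last two are added up). The spectral parameter `λ` is the
indeterminate `RatFunc.X`. -/
def matA {m : ℕ} (f : Fin (m + 1) → K) (a : K) :
    Matrix (Fin (m + 1)) (Fin (m + 1)) (RatFunc K) :=
  fun r c =>
    if r.val < m then
      (if c.val = r.val then RatFunc.C (-f r) else if c.val = r.val + 1 then 1 else 0)
    else
      (if c.val = 0 then RatFunc.X else 0)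
        + (if c.val = 1 then
            -(RatFunc.X * RatFunc.C (bigG f a / (smallG f a * f 0))) else 0)
        + (if c.val = m then RatFunc.C (bigG f a / (smallG f a * f 0) - f (Fin.last m)) else 0)

/-- The matrix `B`. Row `r < m` has the entry `1` on the diagonal and `-f_r` to the right of it; the
last row has `-λ f_m` in column `0`, `λ G / g` in column `1` and `1 - G / g` in column `m`
(for `m = 1` the last two are added up). -/
def matB {m : ℕ} (f : Fin (m + 1) → K) (a : K) :
    Matrix (Fin (m + 1)) (Fin (m + 1)) (RatFunc K) :=
  fun r c =>
    if r.val < m then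
      (if c.val = r.val then 1 else if c.val = r.val + 1 then RatFunc.C (-f r) else 0)
    else
      (if c.val = 0 then -(RatFunc.X * RatFunc.C (f (Fin.last m))) else 0)
        + (if c.val = 1 then RatFunc.X * RatFunc.C (bigG f a / smallG f a) else 0)
        + (if c.val = m then RatFunc.C (1 - bigG f a / smallG f a) else 0)

/-- The Darboux matrix `F[f, a, λ] = B⁻¹ A`, over the field `K(λ)`. -/
def darboux {m : ℕ} (f : Fin (m + 1) → K) (a : K) :
    Matrix (Fin (m + 1)) (Fin (m + 1)) (RatFunc K) :=
  (matB f a)⁻¹ * matA f a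

/-- The expression `B⁻¹ A` makes sense: the denominators `f_0` and `g` in the entries do not vanish
and `B` is invertible over `K(λ)`. -/
def Regular {m : ℕ} (f : Fin (m + 1) → K) (a : K) : Prop :=
  f 0 ≠ 0 ∧ smallG f a ≠ 0 ∧ (matB f a).det ≠ 0

/-- The vector `(f_0, …, f_{m-1})` extended by a last component `f_m`. -/
def extend {m : ℕ} (f : Fin m → K) (fm : K) : Fin (m + 1) → K :=
  Fin.snoc (α := fun _ => K) f fm

/-- The coefficient `γ_{r,s}`. -/
def gam (a b : K) (r s : ℕ) : K := if s ≤ r then 1 else a * b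

/-- The polynomial `P_s`, `0 ≤ s ≤ m`, in `f = f^{(i)}`, `g = f^{(j)}`, with `a = α^{(i)}`,
`b = α^{(j)}`. -/
def P {m : ℕ} (a b : K) (f g : Fin m → K) (s : ℕ) : K :=
  a * ∏ t, g t - b * ∏ t, f t
    + ∑ r : Fin m, gam a b r.val s * (f r - g r) * (∏ t ∈ Finset.Iio r, f t)
        * ∏ t ∈ Finset.Iio r, g t

/-- The mapping `T_j`: the component `i` of `shift α j f` is the vector `T_j(f^{(i)})`, namely
`T_j(f^{(i)}_s) = P^{(i,j)}_{s+1} / (f^{(j)}_s P^{(i,j)}_s)`. Only `i ≠ j` is meant. -/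
def shift {ι : Type*} {m : ℕ} (α : ι → K) (j : ι) (f : ι → Fin m → K) : ι → Fin m → K :=
  fun i s => P (α i) (α j) (f i) (f j) (s.val + 1) / (f j s * P (α i) (α j) (f i) (f j) s.val)

/-- All the denominators in the formula for `T_j(f^{(i)})` are different from zero. -/
def ShiftDefined {ι : Type*} {m : ℕ} (α : ι → K) (j i : ι) (f : ι → Fin m → K) : Prop :=
  ∀ s : Fin m, f j s * P (α i) (α j) (f i) (f j) s.val ≠ 0

/-- The property `S` holds for generic values of the variables `f^{(i)}_s`: it holds outside
the zero set of some nonzero polynomial in these variables. -/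
def Generic {ι : Type*} {m : ℕ} (S : (ι → Fin m → K) → Prop) : Prop :=
  ∃ D : MvPolynomial (ι × Fin m) K, D ≠ 0 ∧
    ∀ f : ι → Fin m → K, MvPolynomial.eval (fun p => f p.1 p.2) D ≠ 0 → S f

/-- The refactorization equation `F[x, α^{(j)}] F[f^{(i)}, α^{(i)}] = F[y, α^{(i)}] F[f^{(j)}, α^{(j)}]`,
as an identity with respect to `λ`, is uniquely solved with respect to `x = T_i(f^{(j)})`,
`y = T_j(f^{(i)})`, and the solution is given by the mapping `shift`. The last components of the
four vectors (the values with subscript `m`) enter the entries of `A` and `B`; they are arbitrary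
as long as the matrices make sense. -/
def UniquelyRefactorizes {ι : Type*} {m : ℕ} (α : ι → K) (i j : ι) (f : ι → Fin m → K) : Prop :=
  (∃ c, Regular (extend (f i) c) (α i)) ∧ (∃ c, Regular (extend (f j) c) (α j)) ∧
  ShiftDefined α i j f ∧ ShiftDefined α j i f ∧
  (∃ c, Regular (extend (shift α i f j) c) (α j)) ∧
  (∃ c, Regular (extend (shift α j f i) c) (α i)) ∧
  ∀ (fm gm : K), Regular (extend (f i) fm) (α i) → Regular (extend (f j) gm) (α j) →
    ∀ (x y : Fin m → K) (xm ym : K), Regular (extend x xm) (α j) → Regular (extend y ym) (α i) →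
      (darboux (extend x xm) (α j) * darboux (extend (f i) fm) (α i)
          = darboux (extend y ym) (α i) * darboux (extend (f j) gm) (α j)
        ↔ x = shift α i f j ∧ y = shift α j f i)

/-- The property `T_k T_j(f^{(i)}_s) = T_j T_k(f^{(i)}_s)`, all terms being defined. In
`T_k T_j(f^{(i)})` the shift `T_k` acts on the arguments of `T_j(f^{(i)})`, so that this is the
mapping `T_j` evaluated at `T_k(f^{(i)})`, `T_k(f^{(j)})`. -/
def CubeConsistent {ι : Type*} {m : ℕ} (α : ι → K) (i j k : ι) (f : ι → Fin m → K) : Prop :=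
  ShiftDefined α k i f ∧ ShiftDefined α k j f ∧ ShiftDefined α j i (shift α k f) ∧
  ShiftDefined α j i f ∧ ShiftDefined α j k f ∧ ShiftDefined α k i (shift α j f) ∧
  ∀ s : Fin m, shift α j (shift α k f) i s = shift α k (shift α j f) i s

end

end DSK

/-!
Put `d_m = α / (f_{m-1} ⋯ f_0)` and `d_s = f_s` for `s < m`, and let `S` be the cyclic shift with
`λ` in the lower left corner. Adding multiples of the row `0` to the last rows turns `B⁻¹ A` into
`F[d] = (1 - d S)⁻¹ (S - d)`, for every `f_m`.

If `x_s κ_{s+1} = κ_s g_s` and `1 - x_s f_s = κ_s (f_s - g_s)` with `s` modulo `m + 1`, then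
`F[x] F[f] = 1 + κ (F[f] - F[g])`, and the right hand side is invariant under `f ↔ g`, `κ ↔ -κ`.
The formula of the theorem gives such `x`, with
`κ_s = (1 - α β) f_{s-1} ⋯ f_0 g_{s-1} ⋯ g_0 / P_s`.

Conversely, `F` is upper triangular at `λ = 0`, so that the diagonal of the equation is
`x_s f_s = y_s g_s`. Together with the superdiagonal, this is a first order recurrence for
`H_s = x_s f_s`. It is solved by `H_{s-1} ⋯ H_0 = 1 - c σ_s`, where `σ_s` is the sum of the terms
`(f_r - g_r) f_{r-1} ⋯ f_0 g_{r-1} ⋯ g_0` with `r < s`. The product of all the `H_s` is `α β`, and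
this determines `c`: the result is `H_{s-1} ⋯ H_0 = P_s / P_0`.

The polynomial `P_s^{(i,j)}` at the vectors shifted by `T_k` is, up to factors which cancel or are
symmetric, a polynomial which is antisymmetric in `j` and `k`. This gives the 3D consistency.
The polynomials in the denominators are nonzero because `P_s` equals `(α - β) f_{m-1} ⋯ f_0` at
`f = g`.
-/

namespace DSK

/-! ### The polynomials `P_s` -/

section PartialProducts

variable {M : Type*} [CommMonoid M] {n : ℕ}

@[to_additive]
lemma partialProd_eq_prod (f : Fin n → M) (s : Fin (n + 1)) :
    Fin.partialProd f s = ∏ t with t.castSucc < s, f t := by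
  simp [Fin.partialProd, List.prod_take_ofFn, Fin.lt_def]

lemma partialProd_last (f : Fin n → M) : Fin.partialProd f (Fin.last n) = ∏ t, f t := by
  simp [partialProd_eq_prod]

lemma prod_Iio_eq_partialProd (f : Fin n → M) (s : Fin n) :
    ∏ t ∈ Iio s, f t = Fin.partialProd f s.castSucc := by
  rw [partialProd_eq_prod]
  exact prod_congr (by ext; simp) fun _ _ => rfl

lemma partialProd_ne_zero {M₀ : Type*} [CommMonoidWithZero M₀] [Nontrivial M₀] [NoZeroDivisors M₀]
    {f : Fin n → M₀} (hf : ∀ t, f t ≠ 0) (s : Fin (n + 1)) : Fin.partialProd f s ≠ 0 := by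
  rw [partialProd_eq_prod]
  exact prod_ne_zero_iff.2 fun t _ => hf t

end PartialProducts

section CrossSums

variable {R : Type*} [CommRing R] {n : ℕ}

/-- The sum of the terms `(f_r - g_r) f_{r-1} ⋯ f_0 g_{r-1} ⋯ g_0` over `r < s`, out of which the
polynomials `P_s` are built. -/
def crossSum (f g : Fin n → R) : Fin (n + 1) → R :=
  Fin.partialSum fun r =>
    (f r - g r) * Fin.partialProd f r.castSucc * Fin.partialProd g r.castSucc

@[simp]
lemma crossSum_zero (f g : Fin n → R) : crossSum f g 0 = 0 :=
  Fin.partialSum_zero _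

lemma crossSum_succ (f g : Fin n → R) (s : Fin n) :
    crossSum f g s.succ = crossSum f g s.castSucc
      + (f s - g s) * Fin.partialProd f s.castSucc * Fin.partialProd g s.castSucc :=
  Fin.partialSum_succ _ s

lemma crossSum_swap (f g : Fin n → R) (s : Fin (n + 1)) : crossSum g f s = -crossSum f g s := by
  induction s using Fin.induction with
  | zero => simp only [crossSum_zero, neg_zero]
  | succ s ih =>
    rw [crossSum_succ, crossSum_succ, ih]
    ring

lemma crossSum_self (f : Fin n → R) (s : Fin (n + 1)) : crossSum f f s = 0 := by
  simp [crossSum, partialSum_eq_sum]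

end CrossSums

section ThePolynomials

variable {K : Type*} [Field K] {m : ℕ}

lemma gam_eq (a b : K) (r : Fin m) (s : Fin (m + 1)) :
    gam a b r s = 1 - if r.castSucc < s then 1 - a * b else 0 := by
  rcases lt_or_ge r.castSucc s with h | h
  · rw [gam, if_neg (show ¬(s : ℕ) ≤ r from not_le.2 h), if_pos h, sub_sub_cancel]
  · rw [gam, if_pos (show (s : ℕ) ≤ r from h), if_neg (not_lt.2 h), sub_zero]

lemma P_eq (a b : K) (f g : Fin m → K) (s : Fin (m + 1)) :
    P a b f g s = a * ∏ t, g t - b * ∏ t, f t + crossSum f g (Fin.last m)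
      - (1 - a * b) * crossSum f g s := by
  simp only [P, gam_eq, prod_Iio_eq_partialProd, sub_mul _ (ite _ _ _), one_mul, ite_mul, zero_mul,
    sum_sub_distrib, crossSum, partialSum_eq_sum, Fin.castSucc_lt_last, filter_true, sum_filter,
    mul_sum, mul_ite, mul_zero, mul_assoc, add_sub_assoc]

lemma P_succ (a b : K) (f g : Fin m → K) (s : Fin m) :
    P a b f g s.succ = P a b f g s.castSucc
      - (1 - a * b) * ((f s - g s) * Fin.partialProd f s.castSucc
        * Fin.partialProd g s.castSucc) := by
  rw [P_eq, P_eq, crossSum_succ]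
  ring

lemma P_swap (a b : K) (f g : Fin m → K) (s : Fin (m + 1)) : P b a g f s = -P a b f g s := by
  rw [P_eq, P_eq, crossSum_swap f g s, crossSum_swap f g (Fin.last m)]
  ring

lemma P_swap_ne_zero {a b : K} {f g : Fin m → K} (hP : ∀ s : Fin (m + 1), P a b f g s ≠ 0)
    (s : Fin (m + 1)) : P b a g f s ≠ 0 := by
  rw [P_swap a b f g]
  exact neg_ne_zero.2 (hP s)

lemma P_zero (a b : K) (f g : Fin m → K) :
    P a b f g (0 : Fin (m + 1)) = a * ∏ t, g t - b * ∏ t, f t + crossSum f g (Fin.last m) := by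
  rw [P_eq, crossSum_zero, mul_zero, sub_zero]

lemma P_last (a b : K) (f g : Fin m → K) :
    P a b f g (Fin.last m) = a * b * P a b f g (0 : Fin (m + 1))
      + (1 - a * b) * (a * ∏ t, g t - b * ∏ t, f t) := by
  rw [P_eq, P_zero]
  ring

lemma P_eq_zero_sub (a b : K) (f g : Fin m → K) (s : Fin (m + 1)) :
    P a b f g s = P a b f g (0 : Fin (m + 1)) - (1 - a * b) * crossSum f g s := by
  rw [P_eq, P_zero]

lemma P_self (a b : K) (f : Fin m → K) (s : Fin (m + 1)) :
    P a b f f s = (a - b) * ∏ t, f t := by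
  rw [P_eq, crossSum_self, crossSum_self]
  ring

end ThePolynomials

/-! ### The refactorization map on the cube -/

section PairShift

variable {K : Type*} [Field K] {m : ℕ}

/-- The vector with the components `P_{s+1} / (g_s P_s)`: the refactorization map of one pair of
vectors `f`, `g` with parameters `a`, `b`, of which `shift` is the indexed form. -/
def pairShift (a b : K) (f g : Fin m → K) : Fin m → K :=
  fun s => P a b f g s.succ / (g s * P a b f g s.castSucc)

variable {a b c : K} {f g h : Fin m → K}

lemma pairShift_ne_zero (hg : ∀ s, g s ≠ 0) (hP : ∀ s : Fin (m + 1), P a b f g s ≠ 0) (s : Fin m) :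
    pairShift a b f g s ≠ 0 :=
  div_ne_zero (hP s.succ) (mul_ne_zero (hg s) (hP s.castSucc))

lemma partialProd_pairShift (hg : ∀ s, g s ≠ 0) (hP : ∀ s : Fin (m + 1), P a b f g s ≠ 0)
    (s : Fin (m + 1)) :
    Fin.partialProd (pairShift a b f g) s
      = P a b f g s / (Fin.partialProd g s * P a b f g (0 : Fin (m + 1))) := by
  have hP0 := hP 0
  induction s using Fin.induction with
  | zero => simp only [Fin.partialProd_zero, one_mul, div_self hP0]
  | succ s ih =>
    have hPs := hP s.castSucc
    have hgs := hg s
    have hprod := partialProd_ne_zero hg s.castSucc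
    rw [Fin.partialProd_succ, Fin.partialProd_succ, ih, pairShift]
    field_simp

lemma prod_pairShift (hg : ∀ s, g s ≠ 0) (hP : ∀ s : Fin (m + 1), P a b f g s ≠ 0) :
    (∏ s, pairShift a b f g s) * ((∏ s, g s) * P a b f g (0 : Fin (m + 1)))
      = P a b f g (Fin.last m) := by
  rw [← partialProd_last, ← partialProd_last, partialProd_pairShift hg hP,
    div_mul_cancel₀ _ (mul_ne_zero (partialProd_ne_zero hg _) (hP 0))]

/-- The numerator of `P^{(i,j)}_s` after the shift `T_k`, for `f`, `g`, `h` the vectors with the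
superscripts `i`, `j`, `k`. Its antisymmetry in `j`, `k` is the 3D consistency. -/
def cubeP (a b c : K) (f g h : Fin m → K) (s : Fin (m + 1)) : K :=
  (1 - a * b) * ((1 - a * c) * P b c g h s * Fin.partialProd f s
      - (1 - b * c) * P a c f h s * Fin.partialProd g s)
    + (1 - b * c) * (1 - a * c) * P a b f g s * Fin.partialProd h s

lemma cubeP_swap (a b c : K) (f g h : Fin m → K) (s : Fin (m + 1)) :
    cubeP a c b f h g s = -cubeP a b c f g h s := by
  rw [cubeP, cubeP, P_swap b c g h]
  ring

lemma crossSum_pairShift (hh : ∀ s, h s ≠ 0) (hP : ∀ s : Fin (m + 1), P a c f h s ≠ 0)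
    (hQ : ∀ s : Fin (m + 1), P b c g h s ≠ 0) (s : Fin (m + 1)) :
    crossSum (pairShift a c f h) (pairShift b c g h) s
        * (P a c f h (0 : Fin (m + 1)) * P b c g h (0 : Fin (m + 1))) * Fin.partialProd h s
      = ((1 - a * c) * P b c g h (0 : Fin (m + 1)) - (1 - b * c) * P a c f h (0 : Fin (m + 1)))
          * Fin.partialProd h s
        - ((1 - a * c) * P b c g h s * Fin.partialProd f s
          - (1 - b * c) * P a c f h s * Fin.partialProd g s)
        + (1 - b * c) * (1 - a * c) * crossSum f g s * Fin.partialProd h s := by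
  have hP0 := hP 0
  have hQ0 := hQ 0
  induction s using Fin.induction with
  | zero => simp
  | succ s ih =>
    have hPs := hP s.castSucc
    have hQs := hQ s.castSucc
    have hprod := partialProd_ne_zero hh s.castSucc
    have hhs := hh s
    have increment : (pairShift a c f h s - pairShift b c g h s)
          * Fin.partialProd (pairShift a c f h) s.castSucc
          * Fin.partialProd (pairShift b c g h) s.castSucc
          * (P a c f h (0 : Fin (m + 1)) * P b c g h (0 : Fin (m + 1)))
          * Fin.partialProd h s.castSucc * h s
        = (b * c - 1) * (h s - g s) * Fin.partialProd g s.castSucc * P a c f h s.castSucc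
          - (a * c - 1) * (h s - f s) * Fin.partialProd f s.castSucc * P b c g h s.castSucc := by
      rw [partialProd_pairShift hh hP, partialProd_pairShift hh hQ, pairShift, pairShift]
      field_simp
      rw [P_succ, P_succ]
      ring
    rw [crossSum_succ, Fin.partialProd_succ, Fin.partialProd_succ, Fin.partialProd_succ,
      crossSum_succ, P_succ, P_succ]
    linear_combination h s * ih + increment

lemma P_zero_pairShift (hh : ∀ s, h s ≠ 0) (hP : ∀ s : Fin (m + 1), P a c f h s ≠ 0)
    (hQ : ∀ s : Fin (m + 1), P b c g h s ≠ 0) :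
    P a b (pairShift a c f h) (pairShift b c g h) (0 : Fin (m + 1))
        * (P a c f h (0 : Fin (m + 1)) * P b c g h (0 : Fin (m + 1)))
      = cubeP a b c f g h 0 := by
  have closing := crossSum_pairShift hh hP hQ (Fin.last m)
  have prod_f := prod_pairShift hh hP
  have prod_g := prod_pairShift hh hQ
  rw [P_last] at prod_f prod_g
  rw [P_last, P_last] at closing
  simp only [partialProd_last] at closing
  simp only [cubeP, Fin.partialProd_zero, P_zero a b]
  apply mul_right_cancel₀ (prod_ne_zero_iff.2 fun s _ => hh s)
  linear_combination closing + a * P a c f h (0 : Fin (m + 1)) * prod_g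
    - b * P b c g h (0 : Fin (m + 1)) * prod_f

lemma P_pairShift (hh : ∀ s, h s ≠ 0) (hP : ∀ s : Fin (m + 1), P a c f h s ≠ 0)
    (hQ : ∀ s : Fin (m + 1), P b c g h s ≠ 0) (s : Fin (m + 1)) :
    P a b (pairShift a c f h) (pairShift b c g h) s
      = cubeP a b c f g h s
        / (P a c f h (0 : Fin (m + 1)) * P b c g h (0 : Fin (m + 1)) * Fin.partialProd h s) := by
  have start := P_zero_pairShift hh hP hQ
  simp only [cubeP, Fin.partialProd_zero] at start
  rw [eq_div_iff (mul_ne_zero (mul_ne_zero (hP 0) (hQ 0)) (partialProd_ne_zero hh s)),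
    P_eq_zero_sub, cubeP, P_eq_zero_sub a b f g s]
  linear_combination Fin.partialProd h s * start - (1 - a * b) * crossSum_pairShift hh hP hQ s

lemma P_pairShift_ne_zero (hh : ∀ s, h s ≠ 0)
    (hP : ∀ s : Fin (m + 1), P a c f h s ≠ 0) (hQ : ∀ s : Fin (m + 1), P b c g h s ≠ 0)
    (hcube : ∀ s : Fin (m + 1), cubeP a b c f g h s ≠ 0) (s : Fin (m + 1)) :
    P a b (pairShift a c f h) (pairShift b c g h) s ≠ 0 := by
  rw [P_pairShift hh hP hQ]
  exact div_ne_zero (hcube s)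
    (mul_ne_zero (mul_ne_zero (hP 0) (hQ 0)) (partialProd_ne_zero hh s))

lemma pairShift_pairShift_apply (hh : ∀ s, h s ≠ 0) (hP : ∀ s : Fin (m + 1), P a c f h s ≠ 0)
    (hQ : ∀ s : Fin (m + 1), P b c g h s ≠ 0) (s : Fin m) :
    pairShift a b (pairShift a c f h) (pairShift b c g h) s
      = cubeP a b c f g h s.succ * P b c g h s.castSucc
        / (P b c g h s.succ * cubeP a b c f g h s.castSucc) := by
  have hP0 := hP 0
  have hQ0 := hQ 0
  have hQs := hQ s.castSucc
  have hhs := hh s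
  have hprod := partialProd_ne_zero hh s.castSucc
  rw [pairShift, P_pairShift hh hP hQ, P_pairShift hh hP hQ, pairShift, Fin.partialProd_succ]
  field_simp

lemma pairShift_pairShift (hg : ∀ s, g s ≠ 0) (hh : ∀ s, h s ≠ 0)
    (hP : ∀ s : Fin (m + 1), P a c f h s ≠ 0) (hQ : ∀ s : Fin (m + 1), P b c g h s ≠ 0)
    (hR : ∀ s : Fin (m + 1), P a b f g s ≠ 0) :
    pairShift a b (pairShift a c f h) (pairShift b c g h)
      = pairShift a c (pairShift a b f g) (pairShift c b h g) := by
  funext s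
  rw [pairShift_pairShift_apply hh hP hQ, pairShift_pairShift_apply hg hR (P_swap_ne_zero hQ),
    cubeP_swap a b c, cubeP_swap a b c, P_swap b c g h, P_swap b c g h, neg_mul_neg, neg_mul_neg]

end PairShift

/-! ### Darboux matrices of cyclic chains -/

section CyclicChain

variable {R S : Type*} [CommRing R] [CommRing S] {m : ℕ}

/-- The matrix with the entry `1` right above the diagonal and `l` in the lower left corner: the
shift of a chain closed up with the spectral parameter `l`. -/
def cyclicShift (m : ℕ) (l : R) : Matrix (Fin (m + 1)) (Fin (m + 1)) R :=
  fun r => Pi.single (r + 1) (if r = Fin.last m then l else 1)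

/-- The matrix `1 - d S`, with `S` the cyclic shift, which plays the part of `B`. -/
def chainDen (l : R) (d : Fin (m + 1) → R) : Matrix (Fin (m + 1)) (Fin (m + 1)) R :=
  1 - Matrix.diagonal d * cyclicShift m l

/-- The matrix `S - d`, with `S` the cyclic shift, which plays the part of `A`. -/
def chainNum (l : R) (d : Fin (m + 1) → R) : Matrix (Fin (m + 1)) (Fin (m + 1)) R :=
  cyclicShift m l - Matrix.diagonal d

/-- The Darboux matrix `(1 - d S)⁻¹ (S - d)` of a cyclic chain with `m + 1` links. -/
noncomputable def chainDarboux (l : R) (d : Fin (m + 1) → R) :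
    Matrix (Fin (m + 1)) (Fin (m + 1)) R :=
  (chainDen l d)⁻¹ * chainNum l d

lemma cyclicShift_castSucc (l : R) (s : Fin m) :
    cyclicShift m l s.castSucc = Pi.single s.succ 1 := by
  rw [cyclicShift, if_neg s.castSucc_lt_last.ne, Fin.coeSucc_eq_succ]

lemma cyclicShift_last (l : R) : cyclicShift m l (Fin.last m) = Pi.single 0 l := by
  rw [cyclicShift, if_pos rfl, Fin.last_add_one]

lemma cyclicShift_mul_apply (l : R) (M : Matrix (Fin (m + 1)) (Fin (m + 1)) R) (r : Fin (m + 1)) :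
    (cyclicShift m l * M) r = (if r = Fin.last m then l else 1) • M (r + 1) := by
  rw [Matrix.mul_apply_eq_vecMul, cyclicShift, Matrix.single_vecMul]
  rfl

lemma cyclicShift_mul_diagonal (l : R) (k : Fin (m + 1) → R) :
    cyclicShift m l * Matrix.diagonal k
      = Matrix.diagonal (fun s => k (s + 1)) * cyclicShift m l := by
  ext r c
  rw [Matrix.mul_diagonal, Matrix.diagonal_mul]
  rcases eq_or_ne c (r + 1) with rfl | h
  · exact mul_comm _ _
  · rw [cyclicShift, Pi.single_eq_of_ne h, zero_mul, mul_zero]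

section Map

variable (φ : R →+* S) (l : R) (d : Fin (m + 1) → R)

lemma map_cyclicShift : φ.mapMatrix (cyclicShift m l) = cyclicShift m (φ l) := by
  ext r c
  simp only [RingHom.mapMatrix_apply, Matrix.map_apply, cyclicShift, Pi.single_apply, apply_ite φ,
    map_one, map_zero]

lemma map_chainDen : φ.mapMatrix (chainDen l d) = chainDen (φ l) (φ ∘ d) := by
  rw [chainDen, map_sub, map_mul, map_one, map_cyclicShift, RingHom.mapMatrix_apply,
    Matrix.diagonal_map (map_zero φ)]
  rfl

lemma map_chainNum : φ.mapMatrix (chainNum l d) = chainNum (φ l) (φ ∘ d) := by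
  rw [chainNum, map_sub, map_cyclicShift, RingHom.mapMatrix_apply,
    Matrix.diagonal_map (map_zero φ)]
  rfl

end Map

variable {l : R}

lemma chainDen_mul_chainDarboux {d : Fin (m + 1) → R} (h : IsUnit (chainDen l d).det) :
    chainDen l d * chainDarboux l d = chainNum l d :=
  Matrix.mul_nonsing_inv_cancel_left _ _ h

lemma map_chainDarboux (φ : R →+* S) {d : Fin (m + 1) → R} (h : IsUnit (chainDen l d).det) :
    φ.mapMatrix (chainDarboux l d) = chainDarboux (φ l) (φ ∘ d) := by
  have h' : IsUnit (chainDen (φ l) (φ ∘ d)).det := by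
    rw [← map_chainDen, ← RingHom.map_det]
    exact h.map φ
  have key := congrArg φ.mapMatrix (chainDen_mul_chainDarboux h)
  rw [map_mul, map_chainDen, map_chainNum] at key
  rw [chainDarboux.eq_def (φ l), ← key, Matrix.nonsing_inv_mul_cancel_left _ _ h']

lemma chainDarboux_eq {d : Fin (m + 1) → R} (h : IsUnit (chainDen l d).det) :
    chainDarboux l d = cyclicShift m l - Matrix.diagonal d
      + Matrix.diagonal d * (cyclicShift m l * chainDarboux l d) := by
  have key := chainDen_mul_chainDarboux h
  rw [chainDen, chainNum, sub_mul, one_mul, mul_assoc] at key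
  exact sub_eq_iff_eq_add.1 key

lemma chainDarboux_mul {f g x κ : Fin (m + 1) → R} (hf : IsUnit (chainDen l f).det)
    (hg : IsUnit (chainDen l g).det) (hx : IsUnit (chainDen l x).det)
    (hshift : ∀ s, x s * κ (s + 1) = κ s * g s) (hdiag : ∀ s, 1 - x s * f s = κ s * (f s - g s)) :
    chainDarboux l x * chainDarboux l f
      = 1 + Matrix.diagonal κ * (chainDarboux l f - chainDarboux l g) := by
  have hF := chainDarboux_eq hf
  have hG := chainDarboux_eq hg
  set S := cyclicShift m l with hS
  set F := chainDarboux l f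
  set G := chainDarboux l g
  have hshift' : Matrix.diagonal x * S * Matrix.diagonal κ
      = Matrix.diagonal κ * Matrix.diagonal g * S := by
    rw [mul_assoc, hS, cyclicShift_mul_diagonal, ← mul_assoc, Matrix.diagonal_mul_diagonal,
      Matrix.diagonal_mul_diagonal]
    simp only [hshift]
  have hdiag' : Matrix.diagonal κ * (Matrix.diagonal f - Matrix.diagonal g)
      = 1 - Matrix.diagonal x * Matrix.diagonal f := by
    simp only [Matrix.diagonal_sub, Matrix.diagonal_mul_diagonal, ← hdiag, ← Matrix.diagonal_one]
  have hFG : F - G - Matrix.diagonal g * (S * (F - G))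
      = (Matrix.diagonal f - Matrix.diagonal g) * (S * F - 1) := by
    linear_combination (norm := noncomm_ring) hF - hG
  have key : chainDen l x * (1 + Matrix.diagonal κ * (F - G)) = chainNum l x * F := calc
    (1 - Matrix.diagonal x * S) * (1 + Matrix.diagonal κ * (F - G))
    _ = 1 - Matrix.diagonal x * S + Matrix.diagonal κ * (F - G)
          - Matrix.diagonal x * S * Matrix.diagonal κ * (F - G) := by noncomm_ring
    _ = 1 - Matrix.diagonal x * S
          + Matrix.diagonal κ * (F - G - Matrix.diagonal g * (S * (F - G))) := by
        rw [hshift']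
        noncomm_ring
    _ = 1 - Matrix.diagonal x * S + (1 - Matrix.diagonal x * Matrix.diagonal f) * (S * F - 1) := by
        rw [hFG, ← hdiag', mul_assoc (Matrix.diagonal κ)]
    _ = S * F - Matrix.diagonal x * (S - Matrix.diagonal f + Matrix.diagonal f * (S * F)) := by
        noncomm_ring
    _ = (S - Matrix.diagonal x) * F := by rw [← hF, sub_mul]
  rw [chainDarboux, mul_assoc, ← key, Matrix.nonsing_inv_mul_cancel_left _ _ hx]

lemma chainDarboux_mul_eq {f g x y κ : Fin (m + 1) → R} (hf : IsUnit (chainDen l f).det)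
    (hg : IsUnit (chainDen l g).det) (hx : IsUnit (chainDen l x).det)
    (hy : IsUnit (chainDen l y).det) (hxκ : ∀ s, x s * κ (s + 1) = κ s * g s)
    (hxf : ∀ s, 1 - x s * f s = κ s * (f s - g s)) (hyκ : ∀ s, y s * κ (s + 1) = κ s * f s)
    (hyg : ∀ s, 1 - y s * g s = κ s * (f s - g s)) :
    chainDarboux l x * chainDarboux l f = chainDarboux l y * chainDarboux l g := by
  have swapped := chainDarboux_mul (κ := -κ) hg hf hy
    (fun s => by simpa only [Pi.neg_apply, mul_neg, neg_mul, neg_inj] using hyκ s)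
    (fun s => by rw [hyg, Pi.neg_apply]; ring)
  have hneg : Matrix.diagonal (-κ) = -Matrix.diagonal κ := (Matrix.diagonal_neg κ).symm
  rw [chainDarboux_mul hf hg hx hxκ hxf, swapped, hneg, neg_mul, ← mul_neg, neg_sub]

end CyclicChain

/-! ### The value at `λ = 0` -/

section UpperTriangular

variable {R : Type*} [Semiring R]

lemma mul_apply_self_of_isUpperTriangular {n : Type*} [Fintype n] [LinearOrder n]
    {M N : Matrix n n R} (hM : M.IsUpperTriangular) (hN : N.IsUpperTriangular) (i : n) :
    (M * N) i i = M i i * N i i := by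
  refine Fintype.sum_eq_single i fun j hji => ?_
  rcases hji.lt_or_gt with h | h
  · exact mul_eq_zero_of_left (hM h) _
  · exact mul_eq_zero_of_right _ (hN h)

lemma mul_castSucc_succ_of_isUpperTriangular {m : ℕ} {M N : Matrix (Fin (m + 1)) (Fin (m + 1)) R}
    (hM : M.IsUpperTriangular) (hN : N.IsUpperTriangular) (s : Fin m) :
    (M * N) s.castSucc s.succ
      = M s.castSucc s.castSucc * N s.castSucc s.succ + M s.castSucc s.succ * N s.succ s.succ := by
  refine Fintype.sum_eq_add _ _ s.castSucc_lt_succ.ne fun j hj => ?_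
  rcases hj.1.lt_or_gt with h | h
  · exact mul_eq_zero_of_left (hM h) _
  · exact mul_eq_zero_of_right _ (hN ((Fin.castSucc_lt_iff_succ_le.1 h).lt_of_ne' hj.2))

end UpperTriangular

section ZeroSpectralParameter

variable {R : Type*} [CommRing R] {m : ℕ} (d : Fin (m + 1) → R)

lemma isUpperTriangular_cyclicShift_zero : (cyclicShift m (0 : R)).IsUpperTriangular := by
  intro r c (h : c < r)
  induction r using Fin.lastCases with
  | last => rw [cyclicShift_last, Pi.single_zero, Pi.zero_apply]
  | cast r =>
    rw [cyclicShift_castSucc, Pi.single_eq_of_ne (h.trans r.castSucc_lt_succ).ne]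

lemma cyclicShift_zero_apply_self (r : Fin (m + 1)) : cyclicShift m (0 : R) r r = 0 := by
  induction r using Fin.lastCases with
  | last => rw [cyclicShift_last, Pi.single_zero, Pi.zero_apply]
  | cast r => rw [cyclicShift_castSucc, Pi.single_eq_of_ne r.castSucc_lt_succ.ne]

lemma det_chainDen_zero : (chainDen 0 d).det = 1 := by
  have h : (chainDen 0 d).IsUpperTriangular := Matrix.blockTriangular_one.sub
    ((Matrix.blockTriangular_diagonal d).mul isUpperTriangular_cyclicShift_zero)
  rw [Matrix.det_of_isUpperTriangular h]
  refine prod_eq_one fun r _ => ?_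
  rw [chainDen, Matrix.sub_apply, Matrix.one_apply_eq, Matrix.diagonal_mul,
    cyclicShift_zero_apply_self, mul_zero, sub_zero]

lemma isUnit_det_chainDen_zero : IsUnit (chainDen 0 d).det :=
  det_chainDen_zero d ▸ isUnit_one

lemma chainDarboux_zero_castSucc (s : Fin m) :
    chainDarboux 0 d s.castSucc = Pi.single s.succ 1 - Pi.single s.castSucc (d s.castSucc)
      + d s.castSucc • chainDarboux 0 d s.succ := by
  funext c
  conv_lhs => rw [chainDarboux_eq (isUnit_det_chainDen_zero d)]
  rw [Matrix.add_apply, Matrix.sub_apply, Matrix.diagonal_mul, cyclicShift_mul_apply,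
    cyclicShift_castSucc, if_neg s.castSucc_lt_last.ne, one_smul, Fin.coeSucc_eq_succ,
    Matrix.diagonal_apply, Pi.add_apply, Pi.sub_apply, Pi.smul_apply, smul_eq_mul,
    Pi.single_apply s.castSucc]
  simp only [eq_comm]

lemma chainDarboux_zero_last :
    chainDarboux 0 d (Fin.last m) = -Pi.single (Fin.last m) (d (Fin.last m)) := by
  funext c
  rw [chainDarboux_eq (isUnit_det_chainDen_zero d), Matrix.add_apply, Matrix.sub_apply,
    Matrix.diagonal_mul, cyclicShift_mul_apply, if_pos rfl, zero_smul, Pi.zero_apply, mul_zero,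
    cyclicShift_last, Pi.single_zero, Pi.zero_apply, Matrix.diagonal_apply, Pi.neg_apply,
    Pi.single_apply, zero_sub, add_zero]
  simp only [eq_comm]

lemma isUpperTriangular_chainDarboux_zero : (chainDarboux 0 d).IsUpperTriangular := by
  suffices h : ∀ r c, c < r → chainDarboux 0 d r c = 0 from fun r c => h r c
  intro r
  induction r using Fin.reverseInduction with
  | last =>
    intro c hc
    rw [chainDarboux_zero_last, Pi.neg_apply, Pi.single_eq_of_ne hc.ne, neg_zero]
  | cast s ih =>
    intro c hc
    have hc' := hc.trans s.castSucc_lt_succ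
    simp [chainDarboux_zero_castSucc, Pi.single_eq_of_ne hc.ne, Pi.single_eq_of_ne hc'.ne, ih c hc']

lemma chainDarboux_zero_apply_self (r : Fin (m + 1)) : chainDarboux 0 d r r = -d r := by
  induction r using Fin.lastCases with
  | last => rw [chainDarboux_zero_last, Pi.neg_apply, Pi.single_eq_same]
  | cast s =>
    have below : chainDarboux 0 d s.succ s.castSucc = 0 :=
      isUpperTriangular_chainDarboux_zero d s.castSucc_lt_succ
    simp [chainDarboux_zero_castSucc, s.castSucc_lt_succ.ne, below]

lemma chainDarboux_zero_castSucc_succ (s : Fin m) :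
    chainDarboux 0 d s.castSucc s.succ = 1 - d s.castSucc * d s.succ := by
  simp [chainDarboux_zero_castSucc, s.castSucc_lt_succ.ne', chainDarboux_zero_apply_self,
    sub_eq_add_neg]

variable {f g x y : Fin (m + 1) → R}

lemma mul_eq_mul_of_chainDarboux_zero
    (h : chainDarboux 0 x * chainDarboux 0 f = chainDarboux 0 y * chainDarboux 0 g)
    (s : Fin (m + 1)) : x s * f s = y s * g s := by
  have key := congrFun₂ h s s
  simpa only [mul_apply_self_of_isUpperTriangular, isUpperTriangular_chainDarboux_zero,
    chainDarboux_zero_apply_self, neg_mul_neg] using key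

lemma superdiagonal_eq_of_chainDarboux_zero
    (h : chainDarboux 0 x * chainDarboux 0 f = chainDarboux 0 y * chainDarboux 0 g) (s : Fin m) :
    (1 - x s.castSucc * x s.succ) * f s.succ + x s.castSucc * (1 - f s.castSucc * f s.succ)
      = (1 - y s.castSucc * y s.succ) * g s.succ
        + y s.castSucc * (1 - g s.castSucc * g s.succ) := by
  have key := congrFun₂ h s.castSucc s.succ
  simp only [mul_castSucc_succ_of_isUpperTriangular, isUpperTriangular_chainDarboux_zero,
    chainDarboux_zero_apply_self, chainDarboux_zero_castSucc_succ] at key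
  linear_combination -key

end ZeroSpectralParameter

section SpectralParameter

open scoped RatFunc

variable {K : Type*} [Field K] {m : ℕ}

lemma isUnit_det_chainDen_powerSeries (d : Fin (m + 1) → K) :
    IsUnit (chainDen PowerSeries.X (PowerSeries.C ∘ d)).det := by
  have h : PowerSeries.constantCoeff ∘ PowerSeries.C ∘ d = d :=
    funext fun s => PowerSeries.constantCoeff_C (d s)
  rw [PowerSeries.isUnit_iff_constantCoeff, RingHom.map_det, map_chainDen, h,
    PowerSeries.constantCoeff_X]
  exact isUnit_det_chainDen_zero d

lemma algebraMap_ratFunc_laurentSeries (p : Polynomial K) :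
    algebraMap (RatFunc K) (LaurentSeries K) (algebraMap _ _ p)
      = algebraMap (PowerSeries K) (LaurentSeries K) p := by
  rw [LaurentSeries.coe_algebraMap]
  exact (RatFunc.coe_coe p).symm

lemma ratFunc_algebraMap_X : algebraMap (RatFunc K) (LaurentSeries K) RatFunc.X
    = algebraMap (PowerSeries K) (LaurentSeries K) PowerSeries.X := by
  rw [← RatFunc.algebraMap_X, algebraMap_ratFunc_laurentSeries, Polynomial.coe_X]

lemma ratFunc_algebraMap_comp_C (d : Fin (m + 1) → K) :
    algebraMap (RatFunc K) (LaurentSeries K) ∘ RatFunc.C ∘ d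
      = algebraMap (PowerSeries K) (LaurentSeries K) ∘ PowerSeries.C ∘ d := by
  funext s
  simp only [Function.comp_apply, ← RatFunc.algebraMap_C, algebraMap_ratFunc_laurentSeries,
    Polynomial.coe_C]

lemma isUnit_det_chainDen (d : Fin (m + 1) → K) :
    IsUnit (chainDen RatFunc.X (RatFunc.C ∘ d)).det := by
  refine isUnit_iff_ne_zero.2 fun h => ?_
  have key := (isUnit_det_chainDen_powerSeries d).map (algebraMap _ (LaurentSeries K))
  rw [RingHom.map_det, map_chainDen, ← ratFunc_algebraMap_X, ← ratFunc_algebraMap_comp_C,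
    ← map_chainDen, ← RingHom.map_det, h, map_zero] at key
  exact not_isUnit_zero key

lemma chainDarboux_zero_mul_eq {f g x y : Fin (m + 1) → K}
    (h : chainDarboux RatFunc.X (RatFunc.C ∘ x) * chainDarboux RatFunc.X (RatFunc.C ∘ f)
      = chainDarboux RatFunc.X (RatFunc.C ∘ y) * chainDarboux RatFunc.X (RatFunc.C ∘ g)) :
    chainDarboux 0 x * chainDarboux 0 f = chainDarboux 0 y * chainDarboux 0 g := by
  have hlaurent (d : Fin (m + 1) → K) :
      (algebraMap (RatFunc K) (LaurentSeries K)).mapMatrix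
          (chainDarboux RatFunc.X (RatFunc.C ∘ d))
        = (algebraMap (PowerSeries K) (LaurentSeries K)).mapMatrix
          (chainDarboux PowerSeries.X (PowerSeries.C ∘ d)) := by
    rw [map_chainDarboux _ (isUnit_det_chainDen d),
      map_chainDarboux _ (isUnit_det_chainDen_powerSeries d), ratFunc_algebraMap_X,
      ratFunc_algebraMap_comp_C]
  have hzero (d : Fin (m + 1) → K) : PowerSeries.constantCoeff.mapMatrix
      (chainDarboux PowerSeries.X (PowerSeries.C ∘ d)) = chainDarboux 0 d := by
    rw [map_chainDarboux _ (isUnit_det_chainDen_powerSeries d), PowerSeries.constantCoeff_X]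
    exact congrArg _ (funext fun s => PowerSeries.constantCoeff_C (d s))
  have hpower := congrArg (algebraMap (RatFunc K) (LaurentSeries K)).mapMatrix h
  rw [map_mul, map_mul, hlaurent, hlaurent, hlaurent, hlaurent, ← map_mul, ← map_mul] at hpower
  have hpower' := Matrix.map_injective (FaithfulSMul.algebraMap_injective _ _) hpower
  rw [← hzero, ← hzero, ← hzero, ← hzero, ← map_mul, ← map_mul, hpower']

end SpectralParameter

/-! ### Closed chains and the refactorization equation -/

section Extend

variable {K : Type*} {m : ℕ} (f : Fin m → K) (c : K)

lemma extend_castSucc (s : Fin m) : extend f c s.castSucc = f s :=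
  Fin.snoc_castSucc (α := fun _ => K) c f s

lemma extend_last : extend f c (Fin.last m) = c :=
  Fin.snoc_last (α := fun _ => K) c f

lemma init_extend : Fin.init (extend f c) = f :=
  Fin.init_snoc (α := fun _ => K) c f

end Extend

section ClosedChain

variable {K : Type*} [Field K] {m : ℕ}

/-- The vector `f` completed to a cyclic chain whose components have the product `a`. -/
noncomputable def closedChain (a : K) (f : Fin m → K) : Fin (m + 1) → K :=
  extend f (a / ∏ t, f t)

lemma closedChain_castSucc (a : K) (f : Fin m → K) (s : Fin m) :
    closedChain a f s.castSucc = f s :=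
  extend_castSucc f _ s

lemma closedChain_last (a : K) (f : Fin m → K) :
    closedChain a f (Fin.last m) = a / ∏ t, f t :=
  extend_last f _

lemma init_closedChain (a : K) (f : Fin m → K) : Fin.init (closedChain a f) = f :=
  init_extend f _

lemma prod_closedChain {f : Fin m → K} (hf : ∀ s, f s ≠ 0) (a : K) :
    ∏ s, closedChain a f s = a := by
  simp only [Fin.prod_univ_castSucc, closedChain_castSucc, closedChain_last]
  exact mul_div_cancel₀ a (prod_ne_zero_iff.2 fun t _ => hf t)

section Existence

/-- The coefficient `κ` of `F[x] F[f] = 1 + κ (F[f] - F[g])`, for `x` the shift of `g`. -/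
noncomputable def kappa (a b : K) (f g : Fin m → K) (s : Fin (m + 1)) : K :=
  (1 - a * b) * Fin.partialProd f s * Fin.partialProd g s / P a b f g s

lemma kappa_swap (a b : K) (f g : Fin m → K) (s : Fin (m + 1)) :
    kappa b a g f s = -kappa a b f g s := by
  rw [kappa, kappa, P_swap a b f g, div_neg]
  ring

variable {a b : K} {f g : Fin m → K}

lemma pairShift_mul_kappa (hf : ∀ s, f s ≠ 0) (hg : ∀ s, g s ≠ 0)
    (hP : ∀ s : Fin (m + 1), P a b f g s ≠ 0) (s : Fin (m + 1)) :
    closedChain a (pairShift a b f g) s * kappa a b f g (s + 1)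
      = kappa a b f g s * closedChain a f s := by
  induction s using Fin.lastCases with
  | cast s =>
    have hPs := hP s.castSucc
    have hPs' := hP s.succ
    have hgs := hg s
    rw [closedChain_castSucc, closedChain_castSucc, Fin.coeSucc_eq_succ, kappa, kappa, pairShift,
      Fin.partialProd_succ, Fin.partialProd_succ]
    field_simp
  | last =>
    have hP0 := hP 0
    have hPm := hP (Fin.last m)
    have hprodf := partialProd_ne_zero hf (Fin.last m)
    have hprodg := partialProd_ne_zero hg (Fin.last m)
    rw [closedChain_last, closedChain_last, Fin.last_add_one, kappa, kappa, Fin.partialProd_zero,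
      Fin.partialProd_zero, ← partialProd_last, ← partialProd_last, partialProd_pairShift hg hP]
    field_simp

lemma one_sub_pairShift_mul (hf : ∀ s, f s ≠ 0) (hg : ∀ s, g s ≠ 0)
    (hP : ∀ s : Fin (m + 1), P a b f g s ≠ 0) (s : Fin (m + 1)) :
    1 - closedChain a (pairShift a b f g) s * closedChain b g s
      = kappa a b f g s * (closedChain a f s - closedChain b g s) := by
  have hPs := hP s
  induction s using Fin.lastCases with
  | cast s =>
    have hgs := hg s
    simp only [closedChain_castSucc, kappa, pairShift, P_succ]
    field_simp
    ring
  | last =>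
    have hprodf := partialProd_ne_zero hf (Fin.last m)
    have hprodg := partialProd_ne_zero hg (Fin.last m)
    have hlast := P_last a b f g
    rw [← partialProd_last, ← partialProd_last] at hlast
    simp only [closedChain_last, kappa, ← partialProd_last, partialProd_pairShift hg hP]
    field_simp
    rw [hlast]
    ring

lemma chainDarboux_pairShift (hf : ∀ s, f s ≠ 0) (hg : ∀ s, g s ≠ 0)
    (hP : ∀ s : Fin (m + 1), P a b f g s ≠ 0) :
    chainDarboux RatFunc.X (RatFunc.C ∘ closedChain b (pairShift b a g f))
        * chainDarboux RatFunc.X (RatFunc.C ∘ closedChain a f)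
      = chainDarboux RatFunc.X (RatFunc.C ∘ closedChain a (pairShift a b f g))
        * chainDarboux RatFunc.X (RatFunc.C ∘ closedChain b g) := by
  have hP' := P_swap_ne_zero hP
  refine chainDarboux_mul_eq (κ := RatFunc.C ∘ kappa a b f g) (isUnit_det_chainDen _)
    (isUnit_det_chainDen _) (isUnit_det_chainDen _) (isUnit_det_chainDen _) (fun s => ?_)
    (fun s => ?_) (fun s => ?_) (fun s => ?_)
  all_goals
    simp only [Function.comp_apply, ← map_mul, ← map_sub, ← map_one (RatFunc.C (K := K))]
    congr 1
  · simpa only [kappa_swap a b f g, mul_neg, neg_mul, neg_inj]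
      using pairShift_mul_kappa hg hf hP' s
  · rw [one_sub_pairShift_mul hg hf hP', kappa_swap a b f g]
    ring
  · exact pairShift_mul_kappa hf hg hP s
  · exact one_sub_pairShift_mul hf hg hP s

end Existence

section Uniqueness

variable {F G H X Y : Fin (m + 1) → K} {c : K}

lemma one_sub_succ_mul_of_chainDarboux_zero
    (h : chainDarboux 0 X * chainDarboux 0 F = chainDarboux 0 Y * chainDarboux 0 G) (s : Fin m) :
    (1 - X s.succ * F s.succ) * (F s.castSucc - G s.castSucc) * (X s.castSucc * F s.castSucc)
      = (1 - X s.castSucc * F s.castSucc) * (F s.succ - G s.succ)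
        * (F s.castSucc * G s.castSucc) := by
  linear_combination
    (1 - X s.succ * F s.succ - G s.castSucc * G s.succ) * F s.castSucc
        * mul_eq_mul_of_chainDarboux_zero h s.castSucc
      - F s.castSucc * G s.castSucc * superdiagonal_eq_of_chainDarboux_zero h s
      - F s.castSucc * G s.castSucc * Y s.castSucc * mul_eq_mul_of_chainDarboux_zero h s.succ

lemma one_sub_mul_partialProd (hFG : ∀ s : Fin m, F s.castSucc ≠ G s.castSucc)
    (hstep : ∀ s : Fin m, (1 - H s.succ) * (F s.castSucc - G s.castSucc) * H s.castSucc
      = (1 - H s.castSucc) * (F s.succ - G s.succ) * (F s.castSucc * G s.castSucc))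
    (hc : 1 - H 0 = c * (F 0 - G 0)) (s : Fin (m + 1)) :
    (1 - H s) * Fin.partialProd (Fin.init H) s
      = c * (F s - G s) * Fin.partialProd (Fin.init F) s * Fin.partialProd (Fin.init G) s := by
  induction s using Fin.induction with
  | zero => simpa only [Fin.partialProd_zero, mul_one] using hc
  | succ s ih =>
    refine mul_left_cancel₀ (sub_ne_zero.2 (hFG s)) ?_
    simp only [Fin.partialProd_succ, Fin.init] at ih ⊢
    linear_combination Fin.partialProd (Fin.init H) s.castSucc * hstep s
      + (F s.succ - G s.succ) * F s.castSucc * G s.castSucc * ih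

lemma partialProd_init_eq_one_sub (h : ∀ s : Fin m,
      (1 - H s.castSucc) * Fin.partialProd (Fin.init H) s.castSucc
        = c * (F s.castSucc - G s.castSucc) * Fin.partialProd (Fin.init F) s.castSucc
          * Fin.partialProd (Fin.init G) s.castSucc) (s : Fin (m + 1)) :
    Fin.partialProd (Fin.init H) s = 1 - c * crossSum (Fin.init F) (Fin.init G) s := by
  induction s using Fin.induction with
  | zero => rw [Fin.partialProd_zero, crossSum_zero, mul_zero, sub_zero]
  | succ s ih =>
    simp only [Fin.partialProd_succ, crossSum_succ, Fin.init]
    linear_combination ih - h s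

variable {a b : K} {f g x y : Fin m → K}

lemma P_zero_mul_partialProd_init (hf : ∀ s, f s ≠ 0) (hg : ∀ s, g s ≠ 0)
    (hprod : ∏ s, H s = a * b)
    (hH : ∀ s, (1 - H s) * Fin.partialProd (Fin.init H) s
      = c * (closedChain a f s - closedChain b g s) * Fin.partialProd f s * Fin.partialProd g s)
    (s : Fin (m + 1)) :
    P a b f g (0 : Fin (m + 1)) * Fin.partialProd (Fin.init H) s = P a b f g s := by
  have hsum (s : Fin (m + 1)) : Fin.partialProd (Fin.init H) s = 1 - c * crossSum f g s := by
    have key := partialProd_init_eq_one_sub (H := H) (F := closedChain a f)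
      (G := closedChain b g) (c := c)
      (fun s => by simpa only [init_closedChain] using hH s.castSucc)
    simpa only [init_closedChain] using key s
  have hprod' : Fin.partialProd (Fin.init H) (Fin.last m) * H (Fin.last m) = a * b := by
    rw [← hprod, Fin.prod_univ_castSucc, partialProd_last]
    rfl
  have hlast : (1 - H (Fin.last m)) * Fin.partialProd (Fin.init H) (Fin.last m)
      = c * (a * ∏ t, g t - b * ∏ t, f t) := by
    have hprodf : ∏ t, f t ≠ 0 := prod_ne_zero_iff.2 fun t _ => hf t
    have hprodg : ∏ t, g t ≠ 0 := prod_ne_zero_iff.2 fun t _ => hg t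
    rw [hH, closedChain_last, closedChain_last, partialProd_last, partialProd_last]
    field_simp
  have hc : c * P a b f g (0 : Fin (m + 1)) = 1 - a * b := by
    rw [P_zero]
    linear_combination hsum (Fin.last m) - hprod' - hlast
  rw [hsum, P_eq_zero_sub a b f g s]
  linear_combination -crossSum f g s * hc

lemma P_succ_eq_P_castSucc_mul (hf : ∀ s, f s ≠ 0) (hg : ∀ s, g s ≠ 0) (hfg : ∀ s, f s ≠ g s)
    (hprod : ∏ s, H s = a * b)
    (hstep : ∀ s : Fin m, (1 - H s.succ)
        * (closedChain a f s.castSucc - closedChain b g s.castSucc) * H s.castSucc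
      = (1 - H s.castSucc) * (closedChain a f s.succ - closedChain b g s.succ)
        * (closedChain a f s.castSucc * closedChain b g s.castSucc)) (s : Fin m) :
    P a b f g s.succ = P a b f g s.castSucc * H s.castSucc := by
  have hFG (t : Fin m) : closedChain a f t.castSucc ≠ closedChain b g t.castSucc := by
    simpa only [closedChain_castSucc] using hfg t
  have hFG0 : closedChain a f 0 - closedChain b g 0 ≠ 0 := by
    have : NeZero m := ⟨s.pos.ne'⟩
    exact sub_ne_zero.2 (hFG 0)
  have hH := one_sub_mul_partialProd hFG hstep (div_mul_cancel₀ _ hFG0).symm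
  simp only [init_closedChain] at hH
  have hprodH := P_zero_mul_partialProd_init hf hg hprod hH
  rw [← hprodH s.succ, ← hprodH s.castSucc, Fin.partialProd_succ, mul_assoc]
  rfl

lemma eq_pairShift_of_chainDarboux_zero (hf : ∀ s, f s ≠ 0) (hg : ∀ s, g s ≠ 0)
    (hfg : ∀ s, f s ≠ g s) (hP : ∀ s : Fin (m + 1), P a b f g s ≠ 0) (hx : ∀ s, x s ≠ 0)
    (h : chainDarboux 0 (closedChain b x) * chainDarboux 0 (closedChain a f)
      = chainDarboux 0 (closedChain a y) * chainDarboux 0 (closedChain b g)) :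
    x = pairShift b a g f ∧ y = pairShift a b f g := by
  have hdiag (s : Fin m) : x s * f s = y s * g s := by
    simpa only [closedChain_castSucc] using mul_eq_mul_of_chainDarboux_zero h s.castSucc
  have hprod : ∏ s, closedChain b x s * closedChain a f s = a * b := by
    rw [prod_mul_distrib, prod_closedChain hx, prod_closedChain hf, mul_comm]
  have hP_succ (s : Fin m) : P a b f g s.succ = P a b f g s.castSucc * (x s * f s) := by
    simpa only [closedChain_castSucc] using P_succ_eq_P_castSucc_mul hf hg hfg hprod
      (one_sub_succ_mul_of_chainDarboux_zero h) s
  constructor <;> funext s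
  · rw [pairShift, P_swap a b f g, P_swap a b f g, mul_neg, neg_div_neg_eq, hP_succ,
      eq_div_iff (mul_ne_zero (hf s) (hP _))]
    ring
  · rw [pairShift, hP_succ, hdiag, eq_div_iff (mul_ne_zero (hg s) (hP _))]
    ring

end Uniqueness

end ClosedChain

/-! ### Reduction of `B⁻¹ A` to a cyclic chain -/

section DarbouxOfChain

variable {K : Type*} [Field K]

section Rows

variable {R : Type*} [CommRing R] {m : ℕ} (l : R) (d : Fin (m + 1) → R)

lemma chainDen_castSucc (s : Fin m) :
    chainDen l d s.castSucc = Pi.single s.castSucc 1 - Pi.single s.succ (d s.castSucc) := by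
  funext c
  simp [chainDen, cyclicShift_castSucc, Matrix.one_eq_pi_single, Pi.single_apply]

lemma chainDen_last :
    chainDen l d (Fin.last m) = Pi.single (Fin.last m) 1 - Pi.single 0 (l * d (Fin.last m)) := by
  funext c
  simp [chainDen, cyclicShift_last, Matrix.one_eq_pi_single, Pi.single_apply, mul_comm l]

lemma chainNum_castSucc (s : Fin m) :
    chainNum l d s.castSucc = Pi.single s.succ 1 - Pi.single s.castSucc (d s.castSucc) := by
  funext c
  simp [chainNum, cyclicShift_castSucc, Matrix.diagonal_apply, Pi.single_apply, eq_comm]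

lemma chainNum_last :
    chainNum l d (Fin.last m) = Pi.single 0 l - Pi.single (Fin.last m) (d (Fin.last m)) := by
  funext c
  simp [chainNum, cyclicShift_last, Matrix.diagonal_apply, Pi.single_apply, eq_comm]

end Rows

section MatrixRows

variable {m : ℕ} (f : Fin (m + 1) → K) (a : K)

lemma matB_castSucc (s : Fin m) : matB f a s.castSucc
    = Pi.single s.castSucc 1 - Pi.single s.succ (RatFunc.C (f s.castSucc)) := by
  funext c
  simp only [matB, Fin.val_castSucc, if_pos s.isLt, Pi.sub_apply, Pi.single_apply, Fin.ext_iff,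
    Fin.val_succ, map_neg]
  split_ifs <;> first | omega | ring

lemma matA_castSucc (s : Fin m) : matA f a s.castSucc
    = Pi.single s.succ 1 - Pi.single s.castSucc (RatFunc.C (f s.castSucc)) := by
  funext c
  simp only [matA, Fin.val_castSucc, if_pos s.isLt, Pi.sub_apply, Pi.single_apply, Fin.ext_iff,
    Fin.val_succ, map_neg]
  split_ifs <;> first | omega | ring

end MatrixRows

section LastRows

variable {k : ℕ} {f d : Fin (k + 2) → K} {a : K}

lemma matB_last (f : Fin (k + 2) → K) (a : K) : matB f a (Fin.last (k + 1))
    = Pi.single 1 (RatFunc.X * RatFunc.C (bigG f a / smallG f a))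
      + Pi.single (Fin.last (k + 1)) (RatFunc.C (1 - bigG f a / smallG f a))
      - Pi.single 0 (RatFunc.X * RatFunc.C (f (Fin.last (k + 1)))) := by
  funext c
  rw [matB, if_neg (show ¬(Fin.last (k + 1)).val < k + 1 from lt_irrefl _)]
  simp only [Pi.add_apply, Pi.sub_apply, Pi.single_apply, Fin.ext_iff, Fin.val_zero, Fin.val_one,
    Fin.val_last]
  split_ifs <;> ring

lemma matA_last (f : Fin (k + 2) → K) (a : K) : matA f a (Fin.last (k + 1))
    = (Pi.single 0 (RatFunc.X : RatFunc K)
      - Pi.single 1 (RatFunc.X * RatFunc.C (bigG f a / (smallG f a * f 0)))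
      + Pi.single (Fin.last (k + 1))
        (RatFunc.C (bigG f a / (smallG f a * f 0) - f (Fin.last (k + 1)))) :
          Fin (k + 2) → RatFunc K) := by
  funext c
  rw [matA, if_neg (show ¬(Fin.last (k + 1)).val < k + 1 from lt_irrefl _)]
  simp only [Pi.add_apply, Pi.sub_apply, Pi.single_apply, Fin.ext_iff, Fin.val_zero, Fin.val_one,
    Fin.val_last]
  split_ifs <;> ring

/-- The quantity `G / (g f_0)` in the last rows of `A` and `B`. -/
noncomputable def lastRatio (f : Fin (k + 2) → K) (a : K) : K :=
  bigG f a / (smallG f a * f 0)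

lemma lastRatio_mul (h0 : f 0 ≠ 0) : lastRatio f a * f 0 = bigG f a / smallG f a := by
  rw [lastRatio, ← div_div, div_mul_cancel₀ _ h0]

lemma matB_last_eq (h0 : f 0 ≠ 0) (hd0 : d 0 = f 0)
    (hd : (1 - lastRatio f a * f 0) * d (Fin.last (k + 1)) = f (Fin.last (k + 1)) - lastRatio f a) :
    matB f a (Fin.last (k + 1))
      = RatFunc.C (1 - lastRatio f a * f 0)
          • chainDen RatFunc.X (RatFunc.C ∘ d) (Fin.last (k + 1))
        + (-(RatFunc.X * RatFunc.C (lastRatio f a))) • chainDen RatFunc.X (RatFunc.C ∘ d) 0 := by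
  have hden0 : chainDen RatFunc.X (RatFunc.C ∘ d) (0 : Fin (k + 2))
      = Pi.single 0 1 - Pi.single 1 (RatFunc.C (d 0) : RatFunc K) :=
    chainDen_castSucc RatFunc.X (RatFunc.C ∘ d) (0 : Fin (k + 1))
  rw [matB_last, hden0, chainDen_last, ← lastRatio_mul h0, hd0, sub_eq_iff_eq_add.1 hd.symm]
  funext c
  simp only [Pi.add_apply, Pi.sub_apply, Pi.smul_apply, Pi.single_apply, smul_eq_mul, map_add,
    map_sub, map_mul, map_one, Function.comp_apply]
  split_ifs <;> ring

lemma matA_last_eq (hd0 : d 0 = f 0)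
    (hd : (1 - lastRatio f a * f 0) * d (Fin.last (k + 1)) = f (Fin.last (k + 1)) - lastRatio f a) :
    matA f a (Fin.last (k + 1))
      = RatFunc.C (1 - lastRatio f a * f 0)
          • chainNum RatFunc.X (RatFunc.C ∘ d) (Fin.last (k + 1))
        + (-(RatFunc.X * RatFunc.C (lastRatio f a))) • chainNum RatFunc.X (RatFunc.C ∘ d) 0 := by
  have hnum0 : chainNum RatFunc.X (RatFunc.C ∘ d) (0 : Fin (k + 2))
      = Pi.single 1 1 - Pi.single 0 (RatFunc.C (d 0) : RatFunc K) :=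
    chainNum_castSucc RatFunc.X (RatFunc.C ∘ d) (0 : Fin (k + 1))
  rw [matA_last, ← lastRatio, hnum0, chainNum_last, hd0, sub_eq_iff_eq_add.1 hd.symm]
  funext c
  simp only [Pi.add_apply, Pi.sub_apply, Pi.smul_apply, Pi.single_apply, smul_eq_mul, map_add,
    map_sub, map_mul, map_one, Function.comp_apply]
  split_ifs <;> ring

lemma det_matB (h0 : f 0 ≠ 0) (hdf : ∀ s : Fin (k + 1), d s.castSucc = f s.castSucc)
    (hd : (1 - lastRatio f a * f 0) * d (Fin.last (k + 1)) = f (Fin.last (k + 1)) - lastRatio f a) :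
    (matB f a).det = RatFunc.C (1 - lastRatio f a * f 0)
      * (chainDen RatFunc.X (RatFunc.C ∘ d)).det := by
  have hrow : matB f a = (chainDen RatFunc.X (RatFunc.C ∘ d)).updateRow (Fin.last (k + 1))
      (matB f a (Fin.last (k + 1))) := by
    funext r
    induction r using Fin.lastCases with
    | last => rw [Matrix.updateRow_self]
    | cast s =>
      rw [Matrix.updateRow_ne s.castSucc_lt_last.ne, matB_castSucc, chainDen_castSucc,
        Function.comp_apply, hdf]
  rw [hrow, matB_last_eq h0 (hdf 0) hd, Matrix.det_updateRow_add, Matrix.det_updateRow_smul,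
    Matrix.det_updateRow_smul, Matrix.updateRow_eq_self,
    Matrix.det_updateRow_eq_zero (Fin.last_pos).ne, mul_zero, add_zero]

lemma matB_mul_chainDarboux (h0 : f 0 ≠ 0) (hdf : ∀ s : Fin (k + 1), d s.castSucc = f s.castSucc)
    (hd : (1 - lastRatio f a * f 0) * d (Fin.last (k + 1)) = f (Fin.last (k + 1)) - lastRatio f a) :
    matB f a * chainDarboux RatFunc.X (RatFunc.C ∘ d) = matA f a := by
  have hrow (r : Fin (k + 2)) : Matrix.vecMul (chainDen RatFunc.X (RatFunc.C ∘ d) r)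
      (chainDarboux RatFunc.X (RatFunc.C ∘ d)) = chainNum RatFunc.X (RatFunc.C ∘ d) r := by
    rw [← Matrix.mul_apply_eq_vecMul, chainDen_mul_chainDarboux (isUnit_det_chainDen d)]
  funext r
  rw [Matrix.mul_apply_eq_vecMul]
  induction r using Fin.lastCases with
  | last =>
    rw [matB_last_eq h0 (hdf 0) hd, matA_last_eq (hdf 0) hd, Matrix.add_vecMul,
      Matrix.smul_vecMul, Matrix.smul_vecMul, hrow, hrow]
  | cast s =>
    have hden := hrow s.castSucc
    rwa [chainDen_castSucc, chainNum_castSucc, Function.comp_apply, hdf, ← matB_castSucc f a,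
      ← matA_castSucc f a] at hden

end LastRows

section Regular

variable {k : ℕ} {f : Fin (k + 2) → K} {a : K}

lemma bigG_eq (f : Fin (k + 2) → K) (a : K) :
    bigG f a = f 0 * (∏ i : Fin k, f i.succ.castSucc) * f (Fin.last (k + 1)) - a := by
  rw [bigG, Fin.prod_univ_castSucc, Fin.prod_univ_succ, Fin.castSucc_zero]

lemma smallG_eq (f : Fin (k + 2) → K) (a : K) :
    smallG f a = ∏ i : Fin k, f i.succ.castSucc - a := by
  rw [smallG, ← Fin.castSucc_zero, ← Fin.map_castSuccEmb_Ioi, prod_map, Fin.prod_Ioi_zero]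
  rfl

lemma det_matB_eq_zero (hg : smallG f a ≠ 0) {s : Fin k} (hs : f s.succ.castSucc = 0) :
    (matB f a).det = 0 := by
  have htail : ∏ i : Fin k, f i.succ.castSucc = 0 := prod_eq_zero (mem_univ s) hs
  have hratio : bigG f a / smallG f a = 1 := by
    rw [div_eq_one_iff_eq hg, bigG_eq, smallG_eq, htail, mul_zero, zero_mul]
  let v : Fin (k + 2) → K := fun r => ∏ t : Fin (k + 1) with r ≤ t.castSucc, f t.castSucc
  have hv_last : v (Fin.last (k + 1)) = 1 := by
    simp [v]
  have hv_castSucc (t : Fin (k + 1)) : v t.castSucc = f t.castSucc * v t.succ := by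
    have := mul_prod_Ioi_eq_prod_Ici (f := fun t : Fin (k + 1) => f t.castSucc) t
    simpa [v, Fin.succ_le_castSucc_iff, filter_le_eq_Ici, filter_lt_eq_Ioi] using this.symm
  have hv_eq_zero {r : Fin (k + 2)} (hr : r ≤ s.succ.castSucc) : v r = 0 :=
    prod_eq_zero (mem_filter.2 ⟨mem_univ _, hr⟩) hs
  have hv_zero : v 0 = 0 := hv_eq_zero (Fin.zero_le _)
  have hv_one : v 1 = 0 := hv_eq_zero (by simp [Fin.le_def])
  refine Matrix.exists_mulVec_eq_zero_iff.1 ⟨RatFunc.C ∘ v, ?_, ?_⟩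
  · exact fun hv => by simpa [hv_last] using congrFun hv (Fin.last (k + 1))
  funext r
  change matB f a r ⬝ᵥ (RatFunc.C ∘ v) = 0
  induction r using Fin.lastCases with
  | last =>
    rw [matB_last, hratio]
    simp [sub_dotProduct, hv_zero, hv_one]
  | cast t =>
    rw [matB_castSucc]
    simp [sub_dotProduct, hv_castSucc]

lemma Regular.ne_zero (h : Regular f a) (s : Fin (k + 1)) : f s.castSucc ≠ 0 := by
  induction s using Fin.cases with
  | zero => exact h.1
  | succ s => exact fun hs => h.2.2 (det_matB_eq_zero h.2.1 hs)

lemma one_sub_lastRatio_mul_closedChain (hf : ∀ s : Fin (k + 1), f s.castSucc ≠ 0)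
    (hg : smallG f a ≠ 0) :
    (1 - lastRatio f a * f 0) * closedChain a (Fin.init f) (Fin.last (k + 1))
      = f (Fin.last (k + 1)) - lastRatio f a := by
  have h0 : f 0 ≠ 0 := hf 0
  have htail : ∏ i : Fin k, f i.succ.castSucc ≠ 0 := prod_ne_zero_iff.2 fun i _ => hf i.succ
  rw [closedChain_last, Fin.prod_univ_succ]
  simp only [Fin.init, Fin.castSucc_zero]
  rw [smallG_eq] at hg
  rw [lastRatio, bigG_eq, smallG_eq]
  field_simp
  ring

lemma Regular.darboux_eq (h : Regular f a) :
    darboux f a = chainDarboux RatFunc.X (RatFunc.C ∘ closedChain a (Fin.init f)) := by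
  rw [darboux, ← matB_mul_chainDarboux h.1 (closedChain_castSucc a (Fin.init f))
    (one_sub_lastRatio_mul_closedChain h.ne_zero h.2.1),
    Matrix.nonsing_inv_mul_cancel_left _ _ h.2.2.isUnit]

lemma regular_extend_zero {f : Fin (k + 1) → K} (hf : ∀ s, f s ≠ 0)
    (ha : ∏ i : Fin k, f i.succ ≠ a) : Regular (extend f 0) a := by
  have hext := extend_castSucc f 0
  have h0 : extend f 0 0 ≠ 0 := by
    rw [← Fin.castSucc_zero, hext]
    exact hf 0
  have hf' (s : Fin (k + 1)) : extend f 0 s.castSucc ≠ 0 := by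
    rw [hext]
    exact hf s
  have htail : ∏ i : Fin k, f i.succ ≠ 0 := prod_ne_zero_iff.2 fun i _ => hf i.succ
  have hg : smallG (extend f 0) a ≠ 0 := by
    simpa only [smallG_eq, hext, sub_ne_zero] using ha
  have hratio : 1 - lastRatio (extend f 0) a * extend f 0 0 ≠ 0 := by
    rw [lastRatio_mul h0, sub_ne_zero, ne_comm, Ne, div_eq_one_iff_eq hg, bigG_eq, smallG_eq,
      extend_last]
    simpa only [hext, mul_zero, sub_left_inj] using htail.symm
  refine ⟨h0, hg, ?_⟩
  rw [det_matB h0 (closedChain_castSucc a (Fin.init (extend f 0)))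
    (one_sub_lastRatio_mul_closedChain hf' hg)]
  exact mul_ne_zero ((map_ne_zero _).2 hratio) (isUnit_det_chainDen _).ne_zero

end Regular

end DarbouxOfChain

/-! ### Generic values -/

section Genericity

variable {K : Type*} [Field K] {ι : Type*} {m : ℕ}

/-- The filter of the sets that contain generic values of the variables `f^{(i)}_s`, so that
`Generic S` is `∀ᶠ f in genericFilter K ι m, S f` by definition. -/
def genericFilter (K ι : Type*) [Field K] (m : ℕ) : Filter (ι → Fin m → K) where
  sets := {S | Generic (· ∈ S)}
  univ_sets := ⟨1, one_ne_zero, fun _ _ => trivial⟩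
  sets_of_superset := fun ⟨D, hD₀, hD⟩ hST => ⟨D, hD₀, fun f hf => hST (hD f hf)⟩
  inter_sets := fun ⟨D, hD₀, hD⟩ ⟨E, hE₀, hE⟩ => ⟨D * E, mul_ne_zero hD₀ hE₀, fun f hf =>
    have hf : MvPolynomial.eval _ D * MvPolynomial.eval _ E ≠ 0 := by rwa [← map_mul]
    ⟨hD f (left_ne_zero_of_mul hf), hE f (right_ne_zero_of_mul hf)⟩⟩

/-- The functions that are given by polynomials in the variables `f^{(i)}_s`. -/
noncomputable def polynomialFunctions (K ι : Type*) [Field K] (m : ℕ) :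
    Subalgebra K ((ι → Fin m → K) → K) :=
  (MvPolynomial.aeval fun (p : ι × Fin m) (f : ι → Fin m → K) => f p.1 p.2).range

lemma eventually_ne_zero {φ : (ι → Fin m → K) → K} (hφ : φ ∈ polynomialFunctions K ι m)
    (h : ∃ f, φ f ≠ 0) : ∀ᶠ f in genericFilter K ι m, φ f ≠ 0 := by
  obtain ⟨D, rfl⟩ := hφ
  obtain ⟨f, hf⟩ := h
  have heval (f : ι → Fin m → K) :
      MvPolynomial.aeval (fun (p : ι × Fin m) (f : ι → Fin m → K) => f p.1 p.2) D f
        = MvPolynomial.eval (fun p => f p.1 p.2) D := by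
    rw [← MvPolynomial.coe_aeval_eq_eval]
    exact MvPolynomial.comp_aeval_apply _ (Pi.evalAlgHom K (fun _ => K) f) D
  refine ⟨D, ?_, fun f hD => (heval f).trans_ne hD⟩
  rintro rfl
  simp at hf

lemma coord_mem_polynomialFunctions (i : ι) (s : Fin m) :
    (fun f : ι → Fin m → K => f i s) ∈ polynomialFunctions K ι m :=
  ⟨MvPolynomial.X (i, s), MvPolynomial.aeval_X _ _⟩

lemma const_mem_polynomialFunctions (c : K) :
    (fun _ : ι → Fin m → K => c) ∈ polynomialFunctions K ι m :=
  (polynomialFunctions K ι m).algebraMap_mem c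

lemma prod_mem_polynomialFunctions {κ : Type*} {Φ : κ → (ι → Fin m → K) → K} (S : Finset κ)
    (hΦ : ∀ t, Φ t ∈ polynomialFunctions K ι m) :
    (fun f => ∏ t ∈ S, Φ t f) ∈ polynomialFunctions K ι m := by
  rw [← prod_fn]
  exact prod_mem fun t _ => hΦ t

lemma partialProd_mem_polynomialFunctions (i : ι) (s : Fin (m + 1)) :
    (fun f : ι → Fin m → K => Fin.partialProd (f i) s) ∈ polynomialFunctions K ι m := by
  simp only [partialProd_eq_prod]
  exact prod_mem_polynomialFunctions _ fun t => coord_mem_polynomialFunctions i t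

lemma crossSum_mem_polynomialFunctions (i j : ι) (s : Fin (m + 1)) :
    (fun f : ι → Fin m → K => crossSum (f i) (f j) s) ∈ polynomialFunctions K ι m := by
  induction s using Fin.induction with
  | zero => simpa only [crossSum_zero] using const_mem_polynomialFunctions 0
  | succ s ih =>
    simp only [crossSum_succ]
    exact add_mem ih (mul_mem (mul_mem
      (sub_mem (coord_mem_polynomialFunctions i s) (coord_mem_polynomialFunctions j s))
      (partialProd_mem_polynomialFunctions i _)) (partialProd_mem_polynomialFunctions j _))

lemma P_mem_polynomialFunctions (a b : K) (i j : ι) (s : Fin (m + 1)) :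
    (fun f : ι → Fin m → K => P a b (f i) (f j) s) ∈ polynomialFunctions K ι m := by
  simp only [P_eq, ← partialProd_last]
  exact sub_mem (add_mem (sub_mem
      (mul_mem (const_mem_polynomialFunctions _) (partialProd_mem_polynomialFunctions j _))
      (mul_mem (const_mem_polynomialFunctions _) (partialProd_mem_polynomialFunctions i _)))
    (crossSum_mem_polynomialFunctions i j _))
    (mul_mem (const_mem_polynomialFunctions _) (crossSum_mem_polynomialFunctions i j s))

lemma cubeP_mem_polynomialFunctions (a b c : K) (i j k : ι) (s : Fin (m + 1)) :
    (fun f : ι → Fin m → K => cubeP a b c (f i) (f j) (f k) s) ∈ polynomialFunctions K ι m :=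
  add_mem (mul_mem (const_mem_polynomialFunctions _) (sub_mem
      (mul_mem (mul_mem (const_mem_polynomialFunctions _) (P_mem_polynomialFunctions b c j k s))
        (partialProd_mem_polynomialFunctions i s))
      (mul_mem (mul_mem (const_mem_polynomialFunctions _) (P_mem_polynomialFunctions a c i k s))
        (partialProd_mem_polynomialFunctions j s))))
    (mul_mem (mul_mem (const_mem_polynomialFunctions _) (P_mem_polynomialFunctions a b i j s))
      (partialProd_mem_polynomialFunctions k s))

lemma eventually_coord_ne_zero (i : ι) : ∀ᶠ f in genericFilter K ι m, ∀ s, f i s ≠ 0 :=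
  Filter.eventually_all.2 fun s =>
    eventually_ne_zero (coord_mem_polynomialFunctions i s) ⟨1, one_ne_zero⟩

lemma eventually_coord_ne {i j : ι} (hij : i ≠ j) :
    ∀ᶠ f in genericFilter K ι m, ∀ s, f i s ≠ f j s := by
  classical
  refine Filter.eventually_all.2 fun s => (eventually_ne_zero
    (sub_mem (coord_mem_polynomialFunctions i s) (coord_mem_polynomialFunctions j s))
    ⟨Pi.single i 1, ?_⟩).mono fun f hf => sub_ne_zero.1 hf
  simp [hij.symm]

lemma eventually_P_ne_zero {a b : K} (hab : a ≠ b) (i j : ι) :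
    ∀ᶠ f in genericFilter K ι m, ∀ s : Fin (m + 1), P a b (f i) (f j) s ≠ 0 := by
  refine Filter.eventually_all.2 fun s =>
    eventually_ne_zero (P_mem_polynomialFunctions a b i j s) ⟨1, ?_⟩
  simp [P_self, sub_ne_zero.2 hab]

lemma cubeP_one (a b c : K) (s : Fin (m + 1)) :
    cubeP a b c 1 1 1 s = (a - b) * (b - c) * (a - c) := by
  simp only [cubeP, P_self, partialProd_eq_prod, Pi.one_apply, prod_const_one]
  ring

lemma eventually_cubeP_ne_zero {a b c : K} (hab : a ≠ b) (hac : a ≠ c) (hbc : b ≠ c)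
    (i j k : ι) :
    ∀ᶠ f in genericFilter K ι m, ∀ s : Fin (m + 1), cubeP a b c (f i) (f j) (f k) s ≠ 0 := by
  refine Filter.eventually_all.2 fun s =>
    eventually_ne_zero (cubeP_mem_polynomialFunctions a b c i j k s) ⟨1, ?_⟩
  simp [cubeP_one, sub_ne_zero.2 hab, sub_ne_zero.2 hac, sub_ne_zero.2 hbc]

end Genericity

section Tail

variable {K : Type*} [Field K] {ι : Type*} {k : ℕ}

lemma exists_pow_ne [Infinite K] {a : K} (ha : k = 0 → a ≠ 1) :
    ∃ t : K, t ≠ 0 ∧ t ^ k ≠ a ∧ a * t ^ k ≠ 1 := by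
  classical
  rcases eq_or_ne a 1 with rfl | h1
  · obtain ⟨t, ht⟩ := Infinite.exists_notMem_finset (insert 0 (Polynomial.nthRootsFinset k (1 : K)))
    have hk : 0 < k := Nat.pos_of_ne_zero fun hk => ha hk rfl
    rw [mem_insert, Polynomial.mem_nthRootsFinset hk, not_or] at ht
    exact ⟨t, ht.1, ht.2, by simpa only [one_mul] using ht.2⟩
  · exact ⟨1, one_ne_zero, by rwa [one_pow, ne_comm], by rwa [one_pow, mul_one]⟩

lemma eventually_prod_succ_ne [Infinite K] {a : K} (ha : k = 0 → a ≠ 1) (i : ι) :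
    ∀ᶠ f in genericFilter K ι (k + 1), ∏ s : Fin k, f i s.succ ≠ a := by
  obtain ⟨t, -, ht, -⟩ := exists_pow_ne ha
  refine (eventually_ne_zero (sub_mem
    (prod_mem_polynomialFunctions univ fun s : Fin k => coord_mem_polynomialFunctions i s.succ)
    (const_mem_polynomialFunctions a)) ⟨fun _ _ => t, ?_⟩).mono fun f hf => sub_ne_zero.1 hf
  simpa [sub_eq_zero] using ht

lemma prod_succ_pairShift {a b : K} {f g : Fin (k + 1) → K} (hg : ∀ s, g s ≠ 0)
    (hP : ∀ s : Fin (k + 2), P a b f g s ≠ 0) :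
    (∏ s : Fin k, pairShift a b f g s.succ)
        * ((∏ s : Fin k, g s.succ) * P a b f g (Fin.succ 0 : Fin (k + 2)))
      = P a b f g (Fin.last (k + 1)) := by
  have first : pairShift a b f g 0 * (g 0 * P a b f g (0 : Fin (k + 2)))
      = P a b f g (Fin.succ 0 : Fin (k + 2)) :=
    div_mul_cancel₀ _ (mul_ne_zero (hg 0) (hP 0))
  rw [← prod_pairShift hg hP, Fin.prod_univ_succ, Fin.prod_univ_succ, ← first]
  ring

lemma eventually_prod_succ_pairShift_ne [Infinite K] {a b : K} (hab : a ≠ b)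
    (ha : k = 0 → a ≠ 1) (i j : ι) :
    ∀ᶠ f in genericFilter K ι (k + 1),
      ∏ s : Fin k, pairShift a b (f i) (f j) s.succ ≠ a := by
  obtain ⟨t, ht₀, -, ht⟩ := exists_pow_ne ha
  have cleared : ∀ᶠ f in genericFilter K ι (k + 1),
      P a b (f i) (f j) (Fin.last (k + 1))
        - a * ((∏ s : Fin k, f j s.succ) * P a b (f i) (f j) (Fin.succ 0 : Fin (k + 2))) ≠ 0 := by
    refine eventually_ne_zero (sub_mem (P_mem_polynomialFunctions a b i j _)
      (mul_mem (const_mem_polynomialFunctions a) (mul_mem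
        (prod_mem_polynomialFunctions univ fun s : Fin k =>
          coord_mem_polynomialFunctions j s.succ)
        (P_mem_polynomialFunctions a b i j _)))) ⟨fun _ _ => t, ?_⟩
    have factored : (a - b) * t ^ (k + 1) - a * (t ^ k * ((a - b) * t ^ (k + 1)))
        = (a - b) * t ^ (k + 1) * (1 - a * t ^ k) := by
      ring
    simp only [P_self, prod_const, card_univ, Fintype.card_fin, factored]
    exact mul_ne_zero (mul_ne_zero (sub_ne_zero.2 hab) (pow_ne_zero _ ht₀))
      (sub_ne_zero.2 ht.symm)
  filter_upwards [cleared, eventually_coord_ne_zero j, eventually_P_ne_zero hab i j]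
    with f hne hj hP hprod
  rw [← prod_succ_pairShift hj hP, hprod, sub_self] at hne
  exact hne rfl

end Tail

section Refactorization

variable {K : Type*} [Field K] {ι : Type*} {m k : ℕ} {α : ι → K} {i j l : ι}

lemma shiftDefined {f : ι → Fin m → K} (hj : ∀ s, f j s ≠ 0)
    (hij : ∀ s : Fin (m + 1), P (α i) (α j) (f i) (f j) s ≠ 0) : ShiftDefined α j i f :=
  fun s => mul_ne_zero (hj s) (hij s.castSucc)

lemma darboux_mul_darboux_eq_iff {a b : K} {f g x y : Fin (k + 1) → K} {fm gm xm ym : K}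
    (hP : ∀ s : Fin (k + 2), P a b f g s ≠ 0) (hfg : ∀ s, f s ≠ g s)
    (hf : Regular (extend f fm) a) (hg : Regular (extend g gm) b)
    (hx : Regular (extend x xm) b) (hy : Regular (extend y ym) a) :
    darboux (extend x xm) b * darboux (extend f fm) a
        = darboux (extend y ym) a * darboux (extend g gm) b
      ↔ x = pairShift b a g f ∧ y = pairShift a b f g := by
  have hne {f : Fin (k + 1) → K} {c a : K} (h : Regular (extend f c) a) (s) : f s ≠ 0 := by
    simpa only [extend_castSucc] using h.ne_zero s
  rw [hf.darboux_eq, hg.darboux_eq, hx.darboux_eq, hy.darboux_eq]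
  simp only [init_extend]
  constructor
  · exact fun h => eq_pairShift_of_chainDarboux_zero (hne hf) (hne hg) hfg hP (hne hx)
      (chainDarboux_zero_mul_eq h)
  · rintro ⟨rfl, rfl⟩
    exact chainDarboux_pairShift (hne hf) (hne hg) hP

lemma uniquelyRefactorizes {f : ι → Fin (k + 1) → K} (hi : ∀ s, f i s ≠ 0) (hj : ∀ s, f j s ≠ 0)
    (hij : ∀ s, f i s ≠ f j s) (hP : ∀ s : Fin (k + 2), P (α i) (α j) (f i) (f j) s ≠ 0)
    (hti : ∏ s : Fin k, f i s.succ ≠ α i) (htj : ∏ s : Fin k, f j s.succ ≠ α j)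
    (hsi : ∏ s : Fin k, pairShift (α i) (α j) (f i) (f j) s.succ ≠ α i)
    (hsj : ∏ s : Fin k, pairShift (α j) (α i) (f j) (f i) s.succ ≠ α j) :
    UniquelyRefactorizes α i j f :=
  ⟨⟨0, regular_extend_zero hi hti⟩, ⟨0, regular_extend_zero hj htj⟩,
    shiftDefined hi (P_swap_ne_zero hP), shiftDefined hj hP,
    ⟨0, regular_extend_zero (pairShift_ne_zero hi (P_swap_ne_zero hP)) hsj⟩,
    ⟨0, regular_extend_zero (pairShift_ne_zero hj hP) hsi⟩,
    fun _ _ hf hg _ _ _ _ hx hy => darboux_mul_darboux_eq_iff hP hij hf hg hx hy⟩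

lemma cubeConsistent {f : ι → Fin m → K} (hj : ∀ s, f j s ≠ 0) (hl : ∀ s, f l s ≠ 0)
    (hij : ∀ s : Fin (m + 1), P (α i) (α j) (f i) (f j) s ≠ 0)
    (hil : ∀ s : Fin (m + 1), P (α i) (α l) (f i) (f l) s ≠ 0)
    (hjl : ∀ s : Fin (m + 1), P (α j) (α l) (f j) (f l) s ≠ 0)
    (hcube : ∀ s : Fin (m + 1), cubeP (α i) (α j) (α l) (f i) (f j) (f l) s ≠ 0) :
    CubeConsistent α i j l f := by
  have hlj := P_swap_ne_zero hjl
  have hcube' (s : Fin (m + 1)) : cubeP (α i) (α l) (α j) (f i) (f l) (f j) s ≠ 0 := by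
    rw [cubeP_swap (α i) (α j) (α l)]
    exact neg_ne_zero.2 (hcube s)
  exact ⟨shiftDefined hl hil, shiftDefined hl hjl,
    shiftDefined (pairShift_ne_zero hl hjl) (P_pairShift_ne_zero hl hil hjl hcube),
    shiftDefined hj hij, shiftDefined hj hlj,
    shiftDefined (pairShift_ne_zero hj hlj) (P_pairShift_ne_zero hj hij hlj hcube'),
    congrFun (pairShift_pairShift hj hl hil hjl hij)⟩

lemma generic_uniquelyRefactorizes [Infinite K] (hij : α i ≠ α j)
    (hone : k = 0 → α i ≠ 1 ∧ α j ≠ 1) :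
    Generic (fun f : ι → Fin (k + 1) → K => UniquelyRefactorizes α i j f) := by
  have hi (hk : k = 0) : α i ≠ 1 := (hone hk).1
  have hj (hk : k = 0) : α j ≠ 1 := (hone hk).2
  change ∀ᶠ f in genericFilter K ι (k + 1), UniquelyRefactorizes α i j f
  filter_upwards [eventually_coord_ne_zero i, eventually_coord_ne_zero j,
    eventually_coord_ne (ne_of_apply_ne α hij), eventually_P_ne_zero hij i j,
    eventually_prod_succ_ne hi i, eventually_prod_succ_ne hj j,
    eventually_prod_succ_pairShift_ne hij hi i j,
    eventually_prod_succ_pairShift_ne hij.symm hj j i] with f using uniquelyRefactorizes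

lemma generic_cubeConsistent (hij : α i ≠ α j) (hil : α i ≠ α l) (hjl : α j ≠ α l) :
    Generic (fun f : ι → Fin m → K => CubeConsistent α i j l f) := by
  change ∀ᶠ f in genericFilter K ι m, CubeConsistent α i j l f
  filter_upwards [eventually_coord_ne_zero j, eventually_coord_ne_zero l,
    eventually_P_ne_zero hij i j, eventually_P_ne_zero hil i l, eventually_P_ne_zero hjl j l,
    eventually_cubeP_ne_zero hij hil hjl i j l] with f using cubeConsistent

end Refactorization

end DSK

theorem mainTheorem4_general {K : Type*} [Field K] [Infinite K] (m : ℕ) (hm : 1 ≤ m)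
    {ι : Type*} (α : ι → K) :
    (∀ i j : ι, α i ≠ α j → (m = 1 → α i ≠ 1 ∧ α j ≠ 1) →
      DSK.Generic (fun f : ι → Fin m → K => DSK.UniquelyRefactorizes α i j f)) ∧
    (∀ i j k : ι, α i ≠ α j → α i ≠ α k → α j ≠ α k →
      DSK.Generic (fun f : ι → Fin m → K => DSK.CubeConsistent α i j k f)) := by
  obtain ⟨k, rfl⟩ := Nat.exists_eq_add_of_le' hm
  exact ⟨fun i j hij hone => DSK.generic_uniquelyRefactorizes hij fun hk => hone (by rw [hk]),
    fun i j k hij hik hjk => DSK.generic_cubeConsistent hij hik hjk⟩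

theorem mainTheorem4 {K : Type*} [Field K] [CharZero K] (m : ℕ) (hm : 1 ≤ m)
    {ι : Type*} (α : ι → K) :
    (∀ i j : ι, α i ≠ α j → (m = 1 → α i ≠ 1 ∧ α j ≠ 1) →
      DSK.Generic (fun f : ι → Fin m → K => DSK.UniquelyRefactorizes α i j f)) ∧
    (∀ i j k : ι, α i ≠ α j → α i ≠ α k → α j ≠ α k →
      DSK.Generic (fun f : ι → Fin m → K => DSK.CubeConsistent α i j k f)) := by
  have := CharZero.infinite K
  exact mainTheorem4_general m hm α
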